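/- Let $\mathcal A$ be a unital complex algebra, let $\mathcal C\subseteq\mathcal B\subseteq\mathcal A$ and $\mathcal C\subseteq\mathcal N\subseteq\mathcal A$ be unital subalgebras, and let $\mathcal A\xrightarrow{\psi}\mathcal B\xrightarrow{\phi}\mathcal C$ be conditional expectations (linear bimodule maps over the respective range algebra restricting to the identity on it); write $\phi$ also for $\phi\circ\psi:\mathcal A\to\mathcal C$. Assume that $\phi:\mathcal B\to\mathcal C$ is faithful, i.e. if $b\in\mathcal B$ satisfies $\phi(bb')=0$ for all $b'\in\mathcal B$, then $b=0$. For a noncrossing partition $\pi$ of $\{1,\dots,n\}$ ($\pi\in NC_n$, ordered by refinement) let $\phi_\pi(X_1,\dots,X_n)$ be defined recursively: $\phi_{\hat 1_n}(X_1,\dots,X_n)=\phi(X_1\cdots X_n)$, and if $\pi\neq\hat1_n$ and $V=\{k,\dots,l\}$ is an interval block of $\pi$ with $l<n$, then $\phi_\pi(X_1,\dots,X_n)=\phi_{\pi\setminus\{V\}}(X_1,\dots,X_{k-1},\phi(X_k\cdots X_l)X_{l+1},\dots,X_n)$. Let $C_n^\phi(X_1,\dots,X_n)=\sum_{\sigma\in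 NC_n}\phi_\sigma(X_1,\dots,X_n)\,\mu(\sigma,\hat1_n)$ be the free cumulants, where $\mu$ is the Möbius function of $NC_n$; define $\psi_\pi$ and $C_n^\psi$ in the same way. **Theorem.** The algebras $\mathcal N$ and $\mathcal B$ are free with amalgamation over $\mathcal C$ with respect to $\phi$ (i.e. $\phi(Y_1\cdots Y_m)=0$ whenever $m\ge1$, the $Y_j$ are taken alternatingly from $\mathcal N$ and $\mathcal B$, and $\phi(Y_j)=0$ for all $j$) if and only if for all $n\ge1$, all $X_1,\dots,X_n\in\mathcal N$ and all $b_1,\dots,b_{n-1}\in\mathcal B$ $$C_n^\psi(X_1b_1,X_2b_2,\dots,X_{n-1}b_{n-1},X_n)=\phi\bigl(C_n^\psi(X_1\phi(b_1),X_2\phi(b_2),\dots,X_{n-1}\phi(b_{n-1}),X_n)\bigr).$$ This condition is equivalent to: for all $n\ge1$, all $X_1,\dots,X_n\in\mathcal N$ and all $b_1,\dots,b_{n-1}\in\mathcal B$ $$C_n^\psi(X_1b_1,X_2b_2,\dots,X_{n-1}b_{n-1},X_n)=C_n^\phi(X_1\phi(b_1),X_2\phi(b_2),\dots,X_{n-1}\phi(b_{n-1}),X_n).$$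 -/

import Mathlib

/-- A conditional expectation of the unital complex algebra `A` onto its unital subalgebra `B`,
regarded as a linear map `A → A` with values in `B`: it restricts to the identity on `B` and is
`B`-bilinear. -/
structure IsCondExp {A : Type*} [Ring A] [Algebra ℂ A] (B : Subalgebra ℂ A) (ψ : A →ₗ[ℂ] A) :
    Prop where
  map_mem : ∀ x : A, ψ x ∈ B
  map_self : ∀ b ∈ B, ψ b = b
  map_bimodule : ∀ b ∈ B, ∀ b' ∈ B, ∀ x : A, ψ (b * x * b') = b * ψ x * b'

/-- Faithfulness of `φ` on the subalgebra `B`: an element `b ∈ B` with `φ (b b') = 0` for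
all `b' ∈ B` is zero. -/
def IsFaithfulOn {A : Type*} [Ring A] [Algebra ℂ A] (φ : A →ₗ[ℂ] A) (B : Subalgebra ℂ A) : Prop :=
  ∀ b ∈ B, (∀ b' ∈ B, φ (b * b') = 0) → b = 0

/-- Freeness of a family `S` of subalgebras with respect to the conditional expectation `φ`
(freeness with amalgamation over the range of `φ`, which is meant to be contained in every
`S i`): alternating products of one or more `φ`-centred elements are `φ`-centred. -/
def IsFreeWithAmalgamation {A : Type*} [Ring A] [Algebra ℂ A] {ι : Type*} (φ : A →ₗ[ℂ] A)
    (S : ι → Subalgebra ℂ A) : Prop :=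
  ∀ (n : ℕ) (i : Fin (n + 1) → ι) (X : Fin (n + 1) → A),
    (∀ j, X j ∈ S (i j)) → (∀ j, φ (X j) = 0) → (∀ j : Fin n, i j.castSucc ≠ i j.succ) →
      φ (List.ofFn X).prod = 0

/-- A set partition, given as an equivalence relation, is noncrossing if there are no
`i < j < k < l` with `i ∼ k`, `j ∼ l` and `i ≁ j`. -/
def IsNoncrossing {n : ℕ} (r : Setoid (Fin n)) : Prop :=
  ¬ ∃ i j k l : Fin n, i < j ∧ j < k ∧ k < l ∧ r i k ∧ r j l ∧ ¬ r i j

/-- The noncrossing partitions of order `n`, ordered by refinement (`π ≤ σ` if every block of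
`π` is contained in a block of `σ`). -/
abbrev NC (n : ℕ) : Type := {r : Setoid (Fin n) // IsNoncrossing r}

noncomputable instance instFintypeNC (n : ℕ) : Fintype (NC n) :=
  have : Finite (Setoid (Fin n)) :=
    Finite.of_injective (fun r : Setoid (Fin n) => (r : Fin n → Fin n → Prop))
      (fun _ _ h => Setoid.ext fun a b => iff_of_eq (congrFun (congrFun h a) b))
  Fintype.ofFinite _

open Classical in
noncomputable instance instLocallyFiniteOrderNC (n : ℕ) : LocallyFiniteOrder (NC n) :=
  Fintype.toLocallyFiniteOrder

/-- The maximal partition with at most one block. -/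
instance instOrderTopNC (n : ℕ) : OrderTop (NC n) where
  top := ⟨⊤, fun ⟨_, _, _, _, _, _, _, _, _, h⟩ => h trivial⟩
  le_top π := (le_top : π.1 ≤ ⊤)

open Classical in
/-- One left-to-right pass through a word of letters carrying their positions.
`open_` holds the letters read so far whose blocks are not yet complete, and `c` is a factor
to be multiplied from the left onto the next letter.  As soon as a block `V = {k, …, l}` is
complete it is (for a noncrossing partition) an interval among the remaining letters; it is
then removed, and `φ (X k ⋯ X l)` is multiplied from the left onto the letter following `X l`.
After the last letter of the whole word that value is the result. -/
noncomputable def partitionedMomentAux {A : Type*} [Ring A] [Algebra ℂ A] (φ : A →ₗ[ℂ] A)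
    {ι : Type*} (r : Setoid ι) : List (ι × A) → A → List (ι × A) → A
  | _, c, [] => c
  | open_, c, (l, x) :: w =>
    if ∃ p ∈ w, r p.1 l then
      partitionedMomentAux φ r (open_ ++ [(l, c * x)]) 1 w
    else
      partitionedMomentAux φ r (open_.filter fun p => ¬ r p.1 l)
        (φ (((open_.filter fun p => r p.1 l).map Prod.snd).prod * (c * x))) w

/-- The partitioned moment functional `φ_π(X₁, …, Xₙ)`: successively, an interval block
`{k, …, l}` is removed from `π` and `X_{l+1}` is replaced by `φ(X_k ⋯ X_l) X_{l+1}`, until one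
block is left, which contributes `φ` of the product of its letters.  The interval block removed
is always the one with the smallest maximum. -/
noncomputable def partitionedMoment {A : Type*} [Ring A] [Algebra ℂ A] (φ : A →ₗ[ℂ] A) {n : ℕ}
    (π : NC n) (X : Fin n → A) : A :=
  partitionedMomentAux φ π.1 [] 1 (List.ofFn fun i => (i, X i))

open Classical in
/-- The partitioned free cumulant
`C_π^φ(X₁, …, Xₙ) = ∑_{σ ≤ π} φ_σ(X₁, …, Xₙ) μ(σ, π)`, with the Möbius function of the lattice
of noncrossing partitions. -/
noncomputable def partitionedCumulant {A : Type*} [Ring A] [Algebra ℂ A] (φ : A →ₗ[ℂ] A) {n : ℕ}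
    (π : NC n) (X : Fin n → A) : A :=
  ∑ σ : NC n with σ ≤ π, IncidenceAlgebra.mu ℤ σ π • partitionedMoment φ σ X

/-- The free cumulant `C_n^φ(X₁, …, Xₙ)`. -/
noncomputable def freeCumulant {A : Type*} [Ring A] [Algebra ℂ A] (φ : A →ₗ[ℂ] A) {n : ℕ}
    (X : Fin n → A) : A :=
  partitionedCumulant φ ⊤ X

/-- The sequence `(X₁ b₁, …, X_n b_n, X_{n+1})`. -/
def interlace {A : Type*} [Mul A] {n : ℕ} (X : Fin (n + 1) → A) (b : Fin n → A) :
    Fin (n + 1) → A :=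
  Fin.snoc (α := fun _ => A) (fun i => X i.castSucc * b i) (X (Fin.last n))

/-! The proof runs through free Wick products. Put `W(∅) = 1` and `W(u a) = W(u) a - ∑ W(u')
ψ(W(u'') a)`, summed over the splittings `u = u' u''`; lists store these words last letter first. By
induction `ψ` kills `W` of every nonempty word (`IsCondExp.map_wick_cons`). Moreover `ψ(W(u) a)` is
the free cumulant of `u a` (`freeCumulant_eq_wordCumulant`): a partitioned moment `ψ_π` is the sum
of nested values of this kind over all noncrossing `ρ ≤ π`, and Möbius inversion isolates `ρ = ⊤`.

Faithfulness turns freeness into the vanishing of `ψ` on alternating centred products that begin and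
end in `N` (`IsFreeWithAmalgamation.map_altWord`); the converse is
`isFreeWithAmalgamation_of_map_altWord`. If the cumulants of `ψ` are those of `φ` with each `b`
replaced by `φ(b)`, such a product equals the Wick product of its letters `xᵢ βᵢ`, because every
correction contains a factor `φ(βᵢ) = 0` or `φ(xᵢ) = 0`; so `ψ` kills it
(`map_altWord_of_wickCumulant`). Conversely, writing `b = (b - φ(b)) + φ(b)` expands the Wick
products of `ψ` into alternating words, and applying `ψ` to the expansion identifies the cumulants
(`wickCumulant_eq_of_map_altWord`).

For the two cumulant conditions, the case of a single letter gives `ψ = φ` on `N`, so cumulants of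
words in `N` agree. -/

/-! ### Convolution over splittings of a word -/

section Convolution

variable {A L : Type*} [Ring A]

/-- Convolution of functions of words, where a word is read from its last letter. -/
def wordConv (f g : List L → A) (o : List L) : A :=
  ∑ k ∈ Finset.range (o.length + 1), f (o.drop k) * g (o.take k)

theorem wordConv_nil (f g : List L → A) : wordConv f g [] = f [] * g [] := by
  simp [wordConv]

theorem wordConv_cons (f g : List L → A) (x : L) (o : List L) :
    wordConv f g (x :: o) = f (x :: o) * g [] + wordConv f (fun u => g (x :: u)) o := by
  rw [wordConv, List.length_cons, Finset.sum_range_succ', add_comm]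
  simp [wordConv]

theorem wordConv_add_right (f g h : List L → A) (o : List L) :
    wordConv f (fun u => g u + h u) o = wordConv f g o + wordConv f h o := by
  simp [wordConv, mul_add, Finset.sum_add_distrib]

theorem wordConv_sub_right (f g h : List L → A) (o : List L) :
    wordConv f (fun u => g u - h u) o = wordConv f g o - wordConv f h o := by
  simp [wordConv, mul_sub, Finset.sum_sub_distrib]

theorem wordConv_mul_right (f g : List L → A) (a : A) (o : List L) :
    wordConv f (fun u => g u * a) o = wordConv f g o * a := by
  simp [wordConv, Finset.sum_mul, mul_assoc]

/-- Both sides sum over the splittings of the word into three consecutive segments. -/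
theorem wordConv_assoc (f g h : List L → A) (o : List L) :
    wordConv (wordConv f g) h o = wordConv f (wordConv g h) o := by
  induction o generalizing h with
  | nil => simp [wordConv_nil, mul_assoc]
  | cons x o ih =>
    simp only [wordConv_cons, wordConv_nil, ih, wordConv_add_right, wordConv_mul_right]
    noncomm_ring

theorem wordConv_map {M : Type*} (f g : List L → A) (e : M → L) (o : List M) :
    wordConv f g (o.map e) = wordConv (fun u => f (u.map e)) (fun u => g (u.map e)) o := by
  simp [wordConv]

/-- If `f` vanishes on nonempty words and is `1` at the empty word, convolution with `f` from the
left is the identity. -/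
theorem wordConv_eq_of_left (f g : List L → A) (h1 : f [] = 1)
    (o : List L) (h0 : ∀ x u, (x :: u) <:+ o → f (x :: u) = 0) :
    wordConv f g o = g o := by
  induction o generalizing g with
  | nil => simp [wordConv_nil, h1]
  | cons x o ih =>
    rw [wordConv_cons, h0 x o (List.suffix_refl _), zero_mul, zero_add,
      ih _ fun y u hu => h0 y u (hu.trans (List.suffix_cons _ _))]

theorem wordConv_congr {f f' g g' : List L → A} {o : List L}
    (hf : ∀ u, u <:+ o → f u = f' u) (hg : ∀ u, u <+: o → g u = g' u) :
    wordConv f g o = wordConv f' g' o :=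
  Finset.sum_congr rfl fun k _ => by
    rw [hf _ (List.drop_suffix k o), hg _ (List.take_prefix k o)]

end Convolution

/-! ### Additivity in one letter -/

section SumAt

variable {A : Type*} [Add A]

/-- The relation between three words that agree except at one place, where the letter of the first
is the sum of the letters of the other two. -/
inductive SumAt : List A → List A → List A → Prop
  | head (x y : A) (o : List A) : SumAt ((x + y) :: o) (x :: o) (y :: o)
  | tail (a : A) {o p q : List A} : SumAt o p q → SumAt (a :: o) (a :: p) (a :: q)

theorem SumAt.length_eq {o p q : List A} (h : SumAt o p q) :
    p.length = o.length ∧ q.length = o.length := by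
  induction h <;> simp_all

theorem SumAt.take_drop {o p q : List A} (h : SumAt o p q) (k : ℕ) :
    (SumAt (o.take k) (p.take k) (q.take k) ∧ p.drop k = o.drop k ∧ q.drop k = o.drop k) ∨
    (SumAt (o.drop k) (p.drop k) (q.drop k) ∧ p.take k = o.take k ∧ q.take k = o.take k) := by
  induction h generalizing k with
  | head x y o =>
    cases k with
    | zero => exact Or.inr ⟨.head _ _ _, rfl, rfl⟩
    | succ k => exact Or.inl ⟨.head _ _ _, rfl, rfl⟩
  | tail a h ih =>
    cases k with
    | zero => exact Or.inr ⟨.tail _ h, rfl, rfl⟩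
    | succ k =>
      rcases ih k with ⟨h1, h2, h3⟩ | ⟨h1, h2, h3⟩
      · exact Or.inl ⟨.tail _ h1, h2, h3⟩
      · exact Or.inr ⟨h1, by simp [h2], by simp [h3]⟩

end SumAt

/-! ### Free Wick products -/

section Wick

variable {A : Type*} [Ring A] [Algebra ℂ A]

/-- The free Wick product of a word (last letter first) with respect to `ψ`. -/
noncomputable def wick (ψ : A →ₗ[ℂ] A) : List A → A
  | [] => 1
  | a :: o => wick ψ o * a -
      ∑ k : Fin (o.length + 1), wick ψ (o.drop k) * ψ (wick ψ (o.take k) * a)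
  termination_by l => l.length
  decreasing_by all_goals (simp; try omega)

/-- The free cumulant of the word `a :: o` (last letter first), in terms of Wick products. -/
noncomputable def wickCumulant (ψ : A →ₗ[ℂ] A) (a : A) (o : List A) : A :=
  ψ (wick ψ o * a)

variable {ψ φ : A →ₗ[ℂ] A} {B : Subalgebra ℂ A}

theorem wick_nil : wick ψ [] = 1 := by rw [wick]

theorem wick_cons (a : A) (o : List A) :
    wick ψ (a :: o) = wick ψ o * a - wordConv (wick ψ) (wickCumulant ψ a) o := by
  rw [wick, wordConv, Finset.sum_range]
  rfl

theorem IsCondExp.map_mul_right (h : IsCondExp B ψ) {b : A} (hb : b ∈ B) (x : A) :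
    ψ (x * b) = ψ x * b := by
  simpa using h.map_bimodule 1 B.one_mem b hb x

theorem IsCondExp.map_mul_left (h : IsCondExp B ψ) {b : A} (hb : b ∈ B) (x : A) :
    ψ (b * x) = b * ψ x := by
  simpa using h.map_bimodule b hb 1 B.one_mem x

theorem IsCondExp.map_map (h : IsCondExp B ψ) (x : A) : ψ (ψ x) = ψ x :=
  h.map_self _ (h.map_mem x)

theorem wickCumulant_mem (h : IsCondExp B ψ) (a : A) (o : List A) : wickCumulant ψ a o ∈ B :=
  h.map_mem _

theorem wickCumulant_mul_right (h : IsCondExp B ψ) (a : A) {b : A} (hb : b ∈ B) (o : List A) :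
    wickCumulant ψ (a * b) o = wickCumulant ψ a o * b := by
  rw [wickCumulant, ← mul_assoc, h.map_mul_right hb, wickCumulant]

theorem wick_mul_right (h : IsCondExp B ψ) (a : A) {b : A} (hb : b ∈ B) (o : List A) :
    wick ψ (a * b :: o) = wick ψ (a :: o) * b := by
  rw [wick_cons, wick_cons, sub_mul, ← wordConv_mul_right, mul_assoc]
  congr 2
  funext u
  exact wickCumulant_mul_right h a hb u

theorem IsCondExp.map_wordConv {L : Type*} (h : IsCondExp B ψ) (f g : List L → A)
    (hg : ∀ u, g u ∈ B) (o : List L) :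
    ψ (wordConv f g o) = wordConv (fun u => ψ (f u)) g o := by
  simp [wordConv, h.map_mul_right (hg _)]

/-- By induction `ψ` kills every correction with a nonempty Wick factor on the left; the remaining
one, with the empty factor, cancels `ψ (wick ψ o * a)`. -/
theorem IsCondExp.map_wick_cons (h : IsCondExp B ψ) (a : A) (o : List A) :
    ψ (wick ψ (a :: o)) = 0 := by
  induction hn : o.length using Nat.strong_induction_on generalizing a o with
  | _ n ih =>
    rw [wick_cons, map_sub, h.map_wordConv _ _ (wickCumulant_mem h a), wordConv_eq_of_left]
    · rw [wickCumulant, sub_self]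
    · simpa [wick_nil] using h.map_self 1 B.one_mem
    · intro x u hu
      have := hu.length_le
      refine ih u.length ?_ x u rfl
      simp at this; omega

theorem wick_zero_cons (o : List A) : wick ψ (0 :: o) = 0 := by
  rw [wick_cons]
  simp [wordConv, wickCumulant]

theorem wick_sumAt {o p q : List A} (h : SumAt o p q) : wick ψ o = wick ψ p + wick ψ q := by
  induction hn : o.length using Nat.strong_induction_on generalizing o p q with
  | _ n ih =>
    cases h with
    | head x y o =>
      simp only [wick_cons, wordConv, wickCumulant, mul_add, map_add, Finset.sum_add_distrib]
      abel
    | @tail a o p q h =>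
      obtain ⟨hp, hq⟩ := h.length_eq
      simp only [List.length_cons] at hn
      have key : wordConv (wick ψ) (wickCumulant ψ a) o =
          wordConv (wick ψ) (wickCumulant ψ a) p + wordConv (wick ψ) (wickCumulant ψ a) q := by
        rw [wordConv, wordConv, wordConv, hp, hq, ← Finset.sum_add_distrib]
        refine Finset.sum_congr rfl fun k hk => ?_
        rcases h.take_drop k with ⟨h1, h2, h3⟩ | ⟨h1, h2, h3⟩
        · rw [h2, h3, wickCumulant, ih (o.take k).length (by simp; omega) h1 rfl, add_mul, map_add,
            mul_add]
          rfl
        · rw [h2, h3, ih (o.drop k).length (by simp; omega) h1 rfl, add_mul]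
      rw [wick_cons, wick_cons, wick_cons, key, ih o.length (by omega) h rfl]
      noncomm_ring

theorem wickCumulant_sumAt {o p q : List A} {a b c : A} (h : SumAt (a :: o) (b :: p) (c :: q)) :
    wickCumulant ψ a o = wickCumulant ψ b p + wickCumulant ψ c q := by
  cases h with
  | head => simp [wickCumulant, mul_add]
  | tail _ h => simp [wickCumulant, wick_sumAt h, add_mul]

end Wick

/-! ### Moments as sums of nested cumulants -/

section MulHead

variable {A ι : Type*} [Monoid A]

/-- The word `w` with its first letter multiplied by `c` from the left. -/
def mulHead (c : A) : List (ι × A) → List (ι × A)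
  | [] => []
  | (l, x) :: w => (l, c * x) :: w

theorem mulHead_one (w : List (ι × A)) : mulHead 1 w = w := by
  cases w <;> simp [mulHead]

end MulHead

section NestedSum

variable {A : Type*} [Ring A] [Algebra ℂ A] {ι : Type*} {ψ : A →ₗ[ℂ] A} {B : Subalgebra ℂ A}

open Classical in
/-- The sum of the nested cumulants of the noncrossing partitions finer than `r`, organized as a
left-to-right pass through the word: each letter is either put on the stack of open letters (last
letter first), or completes a block together with the topmost letters of the stack. The value of a
complete block is carried to the next letter. -/
noncomputable def nestedSum (ψ : A →ₗ[ℂ] A) (r : Setoid ι) :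
    List (ι × A) → A → List (ι × A) → A
  | o, c, [] => if o = [] then c else 0
  | o, c, (l, x) :: w => nestedSum ψ r ((l, c * x) :: o) 1 w +
      ∑ k ∈ Finset.range (o.length + 1),
        if ∀ p ∈ o.take k, r p.1 l then
          nestedSum ψ r (o.drop k) (wickCumulant ψ (c * x) ((o.take k).map Prod.snd)) w
        else 0

theorem nestedSum_mulHead (r : Setoid ι) (o : List (ι × A)) (c d : A) {w : List (ι × A)}
    (hw : w ≠ []) : nestedSum ψ r o c (mulHead d w) = nestedSum ψ r o (c * d) w := by
  cases w with
  | nil => exact absurd rfl hw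
  | cons x w => simp [mulHead, nestedSum, mul_assoc]

/-- Only additivity in the carried factor is needed later, but that factor is absorbed into a letter
which may then stay on the stack, so the induction must allow the sum to sit in either place. -/
theorem nestedSum_add_of_sumAt (r : Setoid ι) {o p q : List (ι × A)} {c d e : A}
    {w : List (ι × A)} (hp : p.map Prod.fst = o.map Prod.fst) (hq : q.map Prod.fst = o.map Prod.fst)
    (h : (SumAt (o.map Prod.snd) (p.map Prod.snd) (q.map Prod.snd) ∧ d = c ∧ e = c) ∨
      (c = d + e ∧ p = o ∧ q = o)) :
    nestedSum ψ r o c w = nestedSum ψ r p d w + nestedSum ψ r q e w := by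
  induction w generalizing o p q c d e with
  | nil =>
    rcases h with ⟨h, rfl, rfl⟩ | ⟨rfl, rfl, rfl⟩
    · have h1 : o ≠ [] := by rintro rfl; simp at h; cases h
      have h2 : p ≠ [] := by rintro rfl; simp at hp; exact h1 hp
      have h3 : q ≠ [] := by rintro rfl; simp at hq; exact h1 hq
      simp [nestedSum, h1, h2, h3]
    · simp only [nestedSum]; split_ifs <;> simp
  | cons y w ih =>
    obtain ⟨l, x⟩ := y
    have lp : p.length = o.length := by simpa using congrArg List.length hp
    have lq : q.length = o.length := by simpa using congrArg List.length hq
    have hS : SumAt ((c * x) :: o.map Prod.snd) ((d * x) :: p.map Prod.snd)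
        ((e * x) :: q.map Prod.snd) := by
      rcases h with ⟨h, rfl, rfl⟩ | ⟨rfl, rfl, rfl⟩
      · exact .tail _ h
      · rw [add_mul]; exact .head _ _ _
    simp only [nestedSum]
    rw [ih (o := (l, c * x) :: o) (p := (l, d * x) :: p) (q := (l, e * x) :: q) (c := 1) (d := 1)
      (e := 1) (by simp [hp]) (by simp [hq]) (Or.inl ⟨hS, rfl, rfl⟩), lp, lq,
      add_add_add_comm, ← Finset.sum_add_distrib]
    congr 1
    refine Finset.sum_congr rfl fun k hk => ?_
    have cp : (∀ a ∈ p.take k, r a.1 l) ↔ ∀ a ∈ o.take k, r a.1 l := by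
      have : ∀ s : List (ι × A), (∀ a ∈ s.take k, r a.1 l) ↔
        ∀ i ∈ (s.map Prod.fst).take k, r i l := by intro s; simp [← List.map_take]
      rw [this, this, hp]
    have cq : (∀ a ∈ q.take k, r a.1 l) ↔ ∀ a ∈ o.take k, r a.1 l := by
      have : ∀ s : List (ι × A), (∀ a ∈ s.take k, r a.1 l) ↔
        ∀ i ∈ (s.map Prod.fst).take k, r i l := by intro s; simp [← List.map_take]
      rw [this, this, hq]
    by_cases hc : ∀ a ∈ o.take k, r a.1 l
    swap
    · rw [if_neg hc, if_neg (mt cp.1 hc), if_neg (mt cq.1 hc), add_zero]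
    rw [if_pos hc, if_pos (cp.2 hc), if_pos (cq.2 hc)]
    have fst_drop : ∀ {s : List (ι × A)}, s.map Prod.fst = o.map Prod.fst →
        (s.drop k).map Prod.fst = (o.drop k).map Prod.fst := by
      intro s hs; rw [List.map_drop, hs, List.map_drop]
    have ext_pair : ∀ {s t : List (ι × A)}, s.map Prod.fst = t.map Prod.fst →
        s.map Prod.snd = t.map Prod.snd → s = t := by
      intro s t h1 h2
      rw [← List.zip_unzip s, ← List.zip_unzip t, List.unzip_eq_map, List.unzip_eq_map, h1, h2]
    apply ih (fst_drop hp) (fst_drop hq)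
    have hK := hS.take_drop (k + 1)
    simp only [List.take_succ_cons, List.drop_succ_cons, ← List.map_take, ← List.map_drop] at hK
    rcases hK with ⟨h1, h2, h3⟩ | ⟨h1, h2, h3⟩
    · exact Or.inr ⟨wickCumulant_sumAt h1, ext_pair (fst_drop hp) h2, ext_pair (fst_drop hq) h3⟩
    · injection h2 with h21 h22
      injection h3 with h31 h32
      exact Or.inl ⟨h1, by rw [h21, h22], by rw [h31, h32]⟩

theorem nestedSum_add (r : Setoid ι) (o : List (ι × A)) (c d : A) (w : List (ι × A)) :
    nestedSum ψ r o (c + d) w = nestedSum ψ r o c w + nestedSum ψ r o d w :=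
  nestedSum_add_of_sumAt r rfl rfl (Or.inr ⟨rfl, rfl, rfl⟩)

/-- `nestedSum` as an additive function of the carried factor. -/
noncomputable def nestedSumHom (ψ : A →ₗ[ℂ] A) (r : Setoid ι) (o w : List (ι × A)) : A →+ A :=
  AddMonoidHom.mk' (fun c => nestedSum ψ r o c w) fun c d => nestedSum_add r o c d w

theorem nestedSumHom_apply (r : Setoid ι) (o w : List (ι × A)) (c : A) :
    nestedSumHom ψ r o w c = nestedSum ψ r o c w := rfl

/-- A stacked letter leaves only with a later letter of its class; without one the stack is never
emptied. -/
theorem nestedSum_eq_zero (r : Setoid ι) {o : List (ι × A)} (c : A) {w : List (ι × A)}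
    {p : ι × A} (hp : p ∈ o) (hw : ∀ q ∈ w, ¬ r p.1 q.1) : nestedSum ψ r o c w = 0 := by
  induction w generalizing o c with
  | nil => rw [nestedSum, if_neg (List.ne_nil_of_mem hp)]
  | cons y w ih =>
    obtain ⟨l, x⟩ := y
    have hw' : ∀ q ∈ w, ¬ r p.1 q.1 := fun q hq => hw q (List.mem_cons_of_mem _ hq)
    rw [nestedSum, ih 1 (List.mem_cons_of_mem _ hp) hw', zero_add]
    refine Finset.sum_eq_zero fun k _ => ?_
    split_ifs with hk
    · rw [ih _ _ hw']
      rw [← List.take_append_drop k o, List.mem_append] at hp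
      exact hp.resolve_left fun h => hw (l, x) (List.mem_cons_self ..) (hk p h)
    · rfl

open Classical in
/-- A stretch of letters exhausting one class of `r` may be replaced by the value of `ψ` at the
product of its letters. -/
theorem nestedSum_class (hψ : IsCondExp B ψ) (r : Setoid ι) (i : ι) {o u w : List (ι × A)}
    {c : A} (hc : c ∈ B) {v : List (ι × A)} (hv : ∀ p ∈ v, r p.1 i) (hu : ∀ p ∈ u, r p.1 i)
    (ho : ∀ p ∈ o, ¬ r p.1 i) (hw : ∀ p ∈ w, ¬ r p.1 i) :
    nestedSum ψ r (v ++ o) c (u ++ w) =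
      nestedSum ψ r o (ψ (wick ψ (v.map Prod.snd) * c * (u.map Prod.snd).prod)) w := by
  induction u generalizing c v with
  | nil =>
    cases v with
    | nil => simp [wick_nil, hψ.map_self c hc]
    | cons p v =>
      -- The class is exhausted with letters still open, so the left side is zero; on the right `ψ`
      -- kills a nonempty Wick product.
      rw [List.nil_append, nestedSum_eq_zero r c (p := p) (by simp)]
      · simp only [List.map_cons, List.map_nil, List.prod_nil, mul_one]
        rw [hψ.map_mul_right hc, hψ.map_wick_cons, zero_mul, ← nestedSumHom_apply, map_zero]
      · intro q hq h
        exact hw q hq (r.trans (r.symm h) (hv p (by simp)))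
  | cons y u ih =>
    obtain ⟨l, x⟩ := y
    have hl : r l i := hu (l, x) (by simp)
    have hu' : ∀ p ∈ u, r p.1 i := fun p hp => hu p (by simp [hp])
    rw [List.cons_append, nestedSum, ← List.cons_append, ih B.one_mem (by simpa [hl] using hv) hu']
    -- A block closed by `l` cannot reach below `v`, since `o` contains no letter of the class.
    have hsub : Finset.range (v.length + 1) ⊆ Finset.range ((v ++ o).length + 1) := by
      intro k; simp; omega
    rw [← Finset.sum_subset hsub]
    · have : ∀ k ∈ Finset.range (v.length + 1),
          (if ∀ p ∈ (v ++ o).take k, r p.1 l then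
            nestedSum ψ r ((v ++ o).drop k)
              (wickCumulant ψ (c * x) (((v ++ o).take k).map Prod.snd)) (u ++ w) else 0) =
          nestedSumHom ψ r o w (ψ (wick ψ ((v.map Prod.snd).drop k) *
            wickCumulant ψ (c * x) ((v.map Prod.snd).take k) * (u.map Prod.snd).prod)) := by
        intro k hk
        have hk' : k ≤ v.length := by simp at hk; omega
        rw [List.take_append_of_le_length hk', List.drop_append_of_le_length hk', if_pos,
          ih (wickCumulant_mem hψ _ _) (fun p hp => hv p (List.mem_of_mem_drop hp)) hu',
          nestedSumHom_apply, List.map_take, List.map_drop]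
        intro p hp
        exact r.trans (hv p (List.mem_of_mem_take hp)) (r.symm hl)
      rw [Finset.sum_congr rfl this, ← map_sum, ← map_sum, ← nestedSumHom_apply, ← map_add,
        ← map_add, ← nestedSumHom_apply, ← Finset.sum_mul]
      -- Pushing and closing add up to `wick ψ v * (c * x)`, by the Wick recursion.
      have hconv := wordConv.eq_1 (wick ψ) (wickCumulant ψ (c * x)) (v.map Prod.snd)
      rw [List.length_map] at hconv
      rw [← hconv]
      simp only [List.map_cons, wick_cons, List.prod_cons]
      congr 2
      noncomm_ring
    · intro k hk1 hk2
      rw [if_neg]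
      simp only [Finset.mem_range] at hk1 hk2
      intro h
      cases o with
      | nil => simp at hk1; omega
      | cons q o =>
        refine ho q (by simp) (r.trans (h q ?_) hl)
        rw [List.take_append]
        obtain ⟨j, hj⟩ : ∃ j, k - v.length = j + 1 := ⟨k - v.length - 1, by omega⟩
        simp [hj]

/-- Allows a rewriting of the tail of a word to be used behind a prefix that avoids the class of
`i`. -/
theorem nestedSum_append_congr (hψ : IsCondExp B ψ) (r : Setoid ι) (i : ι)
    {w₁ w₂ : List (ι × A)}
    (h : ∀ (o : List (ι × A)) (c : A), (∀ p ∈ o, ¬ r p.1 i) → c ∈ B →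
      nestedSum ψ r o c w₁ = nestedSum ψ r o c w₂)
    {o v : List (ι × A)} {c : A} (ho : ∀ p ∈ o, ¬ r p.1 i) (hv : ∀ p ∈ v, ¬ r p.1 i)
    (hc : c ∈ B) : nestedSum ψ r o c (v ++ w₁) = nestedSum ψ r o c (v ++ w₂) := by
  induction v generalizing o c with
  | nil => exact h o c ho hc
  | cons y v ih =>
    obtain ⟨l, x⟩ := y
    have hl : ¬ r l i := hv (l, x) (by simp)
    have hv' : ∀ p ∈ v, ¬ r p.1 i := fun p hp => hv p (by simp [hp])
    rw [List.cons_append, List.cons_append, nestedSum, nestedSum,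
      ih (by simpa [hl] using ho) hv' B.one_mem]
    congr 1
    refine Finset.sum_congr rfl fun k _ => ?_
    rw [ih (fun p hp => ho p (List.mem_of_mem_drop hp)) hv' (wickCumulant_mem hψ _ _)]

theorem List.eq_filter_append_filter {L : Type*} (p : L → Prop) [DecidablePred p] {l : List L}
    (h : l.Pairwise fun a b => p a → p b) :
    l = l.filter (fun a => ¬ p a) ++ l.filter (fun a => p a) := by
  induction l with
  | nil => rfl
  | cons a l ih =>
    rw [List.pairwise_cons] at h
    by_cases ha : p a
    · have hl : ∀ b ∈ l, p b := fun b hb => h.1 b hb ha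
      have h1 : l.filter (fun a => ¬ p a) = [] := by simpa using hl
      have h2 : l.filter (fun a => p a) = l := by simpa using hl
      rw [List.filter_cons_of_neg (by simpa using ha), List.filter_cons_of_pos (by simpa using ha),
        h1, h2]
      rfl
    · rw [List.filter_cons_of_pos (by simpa using ha), List.filter_cons_of_neg (by simpa using ha),
        List.cons_append, ← ih h.2]

-- The moment-cumulant formula for `ψ_π`: removing an interval block from the moment corresponds to
-- summing over all noncrossing partitions of that block.
open Classical in
theorem partitionedMomentAux_eq_nestedSum (hψ : IsCondExp B ψ) {n : ℕ} {r : Setoid (Fin n)}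
    (hr : IsNoncrossing r) {o w : List (Fin n × A)} {c : A} (hc : c ∈ B) (hw : w ≠ [])
    (how : ((o ++ w).map Prod.fst).Pairwise (· < ·)) (ho : ∀ p ∈ o, ∃ q ∈ w, r p.1 q.1) :
    partitionedMomentAux ψ r o c w = nestedSum ψ r [] 1 (o ++ mulHead c w) := by
  induction w generalizing o c with
  | nil => exact absurd rfl hw
  | cons y w ih =>
    obtain ⟨l, x⟩ := y
    rw [partitionedMomentAux]
    split_ifs with hcl
    · obtain ⟨q, hq, hql⟩ := hcl
      rw [ih B.one_mem (List.ne_nil_of_mem hq) (by simpa using how), mulHead_one]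
      · simp [mulHead]
      · intro p hp
        rw [List.mem_append] at hp
        rcases hp with hp | hp
        · obtain ⟨q', hq', h⟩ := ho p hp
          rcases List.mem_cons.1 hq' with rfl | hq'
          · exact ⟨q, hq, r.trans h (r.symm hql)⟩
          · exact ⟨q', hq', h⟩
        · rw [List.mem_singleton] at hp
          subst hp
          exact ⟨q, hq, r.symm hql⟩
    · push Not at hcl
      have how' := how
      simp only [List.map_append, List.map_cons, List.pairwise_append, List.pairwise_cons] at how
      obtain ⟨ho1, ⟨hlw, hw1⟩, how2⟩ := how
      -- Each open letter still has a partner to come, so an open letter outside the class of `l`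
      -- standing after one inside it would produce a crossing.
      have hpw : o.Pairwise fun a b => r a.1 l → r b.1 l := by
        rw [List.pairwise_map] at ho1
        refine ho1.imp_of_mem fun {a b} ha hb hab hal => ?_
        by_contra hbl
        obtain ⟨q, hq, hbq⟩ := ho b hb
        rcases List.mem_cons.1 hq with rfl | hq
        · exact hbl hbq
        · exact hr ⟨a.1, b.1, l, q.1, hab,
            how2 _ (List.mem_map_of_mem hb) _ (by simp), hlw _ (List.mem_map_of_mem hq), hal, hbq,
            fun h => hbl (r.trans (r.symm h) hal)⟩
      have hsplit := List.eq_filter_append_filter (fun p : Fin n × A => r p.1 l) hpw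
      set v := o.filter (fun p => ¬ r p.1 l) with hv
      set u := o.filter (fun p => r p.1 l) with hu
      have hv' : ∀ p ∈ v, ¬ r p.1 l := fun p hp => by simpa using (List.mem_filter.1 hp).2
      have hu' : ∀ p ∈ u ++ [(l, c * x)], r p.1 l := by
        intro p hp
        rcases List.mem_append.1 hp with hp | hp
        · simpa using (List.mem_filter.1 hp).2
        · rw [List.mem_singleton.1 hp]
      have hw' : ∀ p ∈ w, ¬ r p.1 l := hcl
      have hlist : o ++ mulHead c ((l, x) :: w) = v ++ ((u ++ [(l, c * x)]) ++ w) := by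
        conv_lhs => rw [hsplit]
        simp [mulHead]
      rw [hlist]
      have hprod : ((u ++ [(l, c * x)]).map Prod.snd).prod = (u.map Prod.snd).prod * (c * x) := by
        simp
      by_cases hwn : w = []
      · subst hwn
        have hvn : v = [] := by
          rw [List.eq_nil_iff_forall_not_mem]
          intro p hp
          obtain ⟨q, hq, h⟩ := ho p (List.mem_of_mem_filter hp)
          rw [List.mem_singleton.1 hq] at h
          exact hv' p hp h
        rw [hvn, List.nil_append]
        have := nestedSum_class hψ r l (o := []) (v := []) (w := []) B.one_mem (by simp) hu'
          (by simp) (by simp)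
        rw [List.append_nil] at this
        rw [this, hprod]
        simp [partitionedMomentAux, nestedSum, wick_nil]
      · rw [ih (hψ.map_mem _) hwn]
        · refine nestedSum_append_congr hψ r l (fun o' c' ho' hc' => ?_) (by simp) hv' B.one_mem
          rw [nestedSum_mulHead r _ _ _ hwn]
          have := nestedSum_class hψ r l (o := o') (v := []) (w := w) hc' (by simp) hu' ho' hw'
          rw [List.nil_append] at this
          rw [this, hprod]
          simp [wick_nil, hψ.map_mul_left hc']
        · refine how'.sublist (List.Sublist.map _ ?_)
          exact List.Sublist.append List.filter_sublist (List.sublist_cons_self _ _)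
        · intro p hp
          obtain ⟨q, hq, h⟩ := ho p (List.mem_of_mem_filter hp)
          rcases List.mem_cons.1 hq with rfl | hq
          · exact absurd h (hv' p hp)
          · exact ⟨q, hq, h⟩

end NestedSum

/-! ### Dependence of the nested sum on the partition -/

section JoinBlock

variable {n : ℕ}

/-- All blocks of `ρ` outside of `T` are singletons. -/
def NC.SupportedOn (ρ : NC n) (T : List (Fin n)) : Prop :=
  ∀ i j, ρ.1 i j → i = j ∨ (i ∈ T ∧ j ∈ T)

/-- A set of elements none of whose members is separated by a further element may be added to a
noncrossing partition as a new block. -/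
theorem NC.exists_join_block {ρ : NC n} {T s : List (Fin n)} (hρ : ρ.SupportedOn T)
    (hT : ∀ t ∈ T, (∀ i ∈ s, t < i) ∨ (∀ i ∈ s, i < t)) :
    ∃ ρ' : NC n, (∀ i j, ρ'.1 i j ↔ ρ.1 i j ∨ (i ∈ s ∧ j ∈ s)) ∧
      ∀ τ : NC n, ρ' ≤ τ ↔ ρ ≤ τ ∧ ∀ i ∈ s, ∀ j ∈ s, τ.1 i j := by
  have hd : ∀ t ∈ T, t ∉ s := fun t ht hs => by
    rcases hT t ht with h | h <;> exact lt_irrefl _ (h t hs)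
  refine ⟨⟨⟨fun i j => ρ.1 i j ∨ (i ∈ s ∧ j ∈ s), ?_, ?_, ?_⟩, ?_⟩, ?_, ?_⟩
  · exact fun i => Or.inl (ρ.1.refl i)
  · rintro i j (h | h)
    · exact Or.inl (ρ.1.symm h)
    · exact Or.inr h.symm
  · rintro i j k (h | h) (h' | h')
    · exact Or.inl (ρ.1.trans h h')
    · rcases hρ i j h with rfl | ⟨_, hj⟩
      · exact Or.inr h'
      · exact absurd h'.1 (hd j hj)
    · rcases hρ j k h' with rfl | ⟨hj, _⟩
      · exact Or.inr h
      · exact absurd h.2 (hd j hj)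
    · exact Or.inr ⟨h.1, h'.2⟩
  · rintro ⟨i, j, k, l, hij, hjk, hkl, hik, hjl, hn⟩
    replace hik : ρ.1 i k ∨ (i ∈ s ∧ k ∈ s) := hik
    replace hjl : ρ.1 j l ∨ (j ∈ s ∧ l ∈ s) := hjl
    replace hn : ¬ (ρ.1 i j ∨ (i ∈ s ∧ j ∈ s)) := hn
    rcases hik with h | h <;> rcases hjl with h' | h'
    · exact ρ.2 ⟨i, j, k, l, hij, hjk, hkl, h, h', fun h => hn (Or.inl h)⟩
    · rcases hρ i k h with h | ⟨_, hk⟩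
      · exact absurd h (hij.trans hjk).ne
      · rcases hT k hk with hk | hk
        · exact lt_asymm hjk (hk j h'.1)
        · exact lt_asymm hkl (hk l h'.2)
    · rcases hρ j l h' with h' | ⟨hj, _⟩
      · exact absurd h' (hjk.trans hkl).ne
      · rcases hT j hj with hj | hj
        · exact lt_asymm hij (hj i h.1)
        · exact lt_asymm hjk (hj k h.2)
    · exact hn (Or.inr ⟨h.1, h'.1⟩)
  · exact fun i j => Iff.rfl
  · intro τ
    constructor
    · intro h
      exact ⟨fun i j hij => h (Or.inl hij), fun i hi j hj => h (Or.inr ⟨hi, hj⟩)⟩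
    · rintro ⟨h, h'⟩ i j (hij | hij)
      · exact h hij
      · exact h' i hij.1 j hij.2

end JoinBlock

section Sorted

variable {A : Type*} {n : ℕ}

theorem pairwise_drop_append {o w : List (Fin n × A)} {y : Fin n × A} (k : ℕ)
    (how : ((o.reverse ++ y :: w).map Prod.fst).Pairwise (· < ·)) :
    (((o.drop k).reverse ++ w).map Prod.fst).Pairwise (· < ·) := by
  refine how.sublist (List.Sublist.map _ ?_)
  exact List.Sublist.append (List.reverse_sublist.2 (List.drop_sublist _ _))
    (List.sublist_cons_self _ _)

end Sorted

section CoarserSpan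

variable {A : Type*} [Ring A] {n : ℕ}

open Classical in
/-- The functions on noncrossing partitions spanned by `τ ↦ [ρ ≤ τ] a`, where `ρ` satisfies `P`. -/
def coarserSpan (A : Type*) [Ring A] {n : ℕ} (P : NC n → Prop) : AddSubgroup (NC n → A) :=
  AddSubgroup.closure {f | ∃ (ρ : NC n) (a : A), P ρ ∧ f = fun τ => if ρ ≤ τ then a else 0}

theorem coarserSpan_mono {P Q : NC n → Prop} (h : ∀ ρ, P ρ → Q ρ) :
    coarserSpan A P ≤ coarserSpan A Q := by
  refine AddSubgroup.closure_mono ?_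
  rintro _ ⟨ρ, a, hρ, rfl⟩
  exact ⟨ρ, a, h ρ hρ, rfl⟩

open Classical in
theorem coarserSpan_restrict {P Q : NC n → Prop} (S : NC n → Prop) [DecidablePred S]
    (h : ∀ ρ, P ρ → ∃ ρ', Q ρ' ∧ ∀ τ, ρ' ≤ τ ↔ ρ ≤ τ ∧ S τ) {g : NC n → A}
    (hg : g ∈ coarserSpan A P) : (fun τ => if S τ then g τ else 0) ∈ coarserSpan A Q := by
  induction hg using AddSubgroup.closure_induction with
  | mem g hg =>
    obtain ⟨ρ, a, hρ, rfl⟩ := hg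
    obtain ⟨ρ', hρ', hle⟩ := h ρ hρ
    refine AddSubgroup.subset_closure ⟨ρ', a, hρ', ?_⟩
    funext τ
    simp only [hle]
    split_ifs <;> tauto
  | zero =>
    convert (coarserSpan A Q).zero_mem using 1
    funext τ
    simp
  | add f g _ _ hf hg =>
    convert (coarserSpan A Q).add_mem hf hg using 1
    funext τ
    simp only [Pi.add_apply]
    split_ifs <;> simp
  | neg f _ hf =>
    convert (coarserSpan A Q).neg_mem hf using 1
    funext τ
    simp only [Pi.neg_apply]
    split_ifs <;> simp

-- For `ρ ≠ ⊤` the Möbius function sums to zero over `[ρ, ⊤]`.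
open Classical in
theorem sum_mu_smul_of_mem_coarserSpan {g : NC n → A}
    (hg : g ∈ coarserSpan A fun ρ : NC n => ∃ i j, ¬ ρ.1 i j) :
    ∑ σ : NC n, IncidenceAlgebra.mu ℤ σ ⊤ • g σ = 0 := by
  induction hg using AddSubgroup.closure_induction with
  | mem g hg =>
    obtain ⟨ρ, a, ⟨i, j, hij⟩, rfl⟩ := hg
    have hne : ρ ≠ ⊤ := by rintro rfl; exact hij trivial
    have := IncidenceAlgebra.sum_Icc_mu_left (𝕜 := ℤ) ρ (⊤ : NC n)
    rw [if_neg hne] at this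
    simp only [smul_ite, smul_zero]
    rw [← Finset.sum_filter, ← Finset.sum_smul]
    convert zero_smul ℤ a
    rw [← this]
    refine Finset.sum_congr ?_ fun _ _ => rfl
    ext σ
    simp
  | zero => simp
  | add f g _ _ hf hg => simp only [Pi.add_apply, smul_add, Finset.sum_add_distrib, hf, hg, add_zero]
  | neg f _ hf => simp only [Pi.neg_apply, smul_neg, Finset.sum_neg_distrib, hf, neg_zero]

end CoarserSpan

/-! ### Möbius inversion: free cumulants from Wick products -/

section MoebiusInversion

variable {A : Type*} [Ring A] [Algebra ℂ A] {n : ℕ} {ψ : A →ₗ[ℂ] A} {B : Subalgebra ℂ A}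

-- The closing condition says that `τ` joins the closed block. Adding this block to each `ρ` keeps
-- it noncrossing, and `l` stays unrelated to the letters still to come.
open Classical in
theorem nestedSum_close_mem_coarserSpan {o w : List (Fin n × A)} {l : Fin n} {x c : A} (k : ℕ)
    (how : ((o.reverse ++ (l, x) :: w).map Prod.fst).Pairwise (· < ·))
    (h : (fun τ : NC n => nestedSum ψ τ.1 (o.drop k) c w) ∈
      coarserSpan A fun ρ => ρ.SupportedOn ((o.drop k ++ w).map Prod.fst)) :
    (fun τ : NC n => if ∀ p ∈ o.take k, τ.1 p.1 l then nestedSum ψ τ.1 (o.drop k) c w else 0) ∈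
      coarserSpan A fun ρ => ρ.SupportedOn ((o ++ (l, x) :: w).map Prod.fst) ∧
        ∀ q ∈ w, ¬ ρ.1 l q.1 := by
  refine coarserSpan_restrict (fun τ : NC n => ∀ p ∈ o.take k, τ.1 p.1 l) (fun ρ hρ => ?_) h
  have hsplit : o.reverse = (o.drop k).reverse ++ (o.take k).reverse := by
    rw [← List.reverse_append, List.take_append_drop]
  rw [hsplit] at how
  simp only [List.map_append, List.map_cons, List.pairwise_append, List.pairwise_cons,
    List.append_assoc, List.mem_append, List.mem_cons] at how
  obtain ⟨-, ⟨-, ⟨h1, -⟩, h2⟩, h3⟩ := how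
  -- The rest of the stack precedes the new block and the unread letters follow it.
  obtain ⟨ρ', hρ', hle⟩ := NC.exists_join_block (s := l :: (o.take k).map Prod.fst) hρ (by
    intro t ht
    rw [List.map_append, List.mem_append] at ht
    rcases ht with ht | ht
    · left
      intro i hi
      refine h3 t (by simpa using ht) i ?_
      rcases List.mem_cons.1 hi with rfl | hi
      · exact Or.inr (Or.inl rfl)
      · exact Or.inl (by simpa using hi)
    · right
      intro i hi
      rcases List.mem_cons.1 hi with rfl | hi
      · exact h1 t ht
      · exact h2 i (by simpa using hi) t (Or.inr ht))
  have hlw : ∀ q ∈ w, l < q.1 := fun q hq => h1 _ (List.mem_map_of_mem hq)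
  have hlo : ∀ q ∈ o.drop k, q.1 < l := fun q hq =>
    h3 _ (by rw [List.map_reverse, List.mem_reverse]; exact List.mem_map_of_mem hq) l
      (Or.inr (Or.inl rfl))
  have hlT : l ∉ (o.drop k ++ w).map Prod.fst := by
    intro hl
    obtain ⟨q, hq, rfl⟩ := List.mem_map.1 hl
    rcases List.mem_append.1 hq with hq | hq
    · exact lt_irrefl _ (hlo q hq)
    · exact lt_irrefl _ (hlw q hq)
  refine ⟨ρ', ⟨?_, ?_⟩, ?_⟩
  · have hsub1 : ∀ i ∈ (o.drop k ++ w).map Prod.fst, i ∈ (o ++ (l, x) :: w).map Prod.fst := by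
      intro i hi
      obtain ⟨q, hq, rfl⟩ := List.mem_map.1 hi
      refine List.mem_map_of_mem ?_
      rcases List.mem_append.1 hq with hq | hq
      · exact List.mem_append_left _ (List.mem_of_mem_drop hq)
      · exact List.mem_append_right _ (List.mem_cons_of_mem _ hq)
    have hsub2 : ∀ i ∈ l :: (o.take k).map Prod.fst, i ∈ (o ++ (l, x) :: w).map Prod.fst := by
      intro i hi
      rcases List.mem_cons.1 hi with rfl | hi
      · simp
      · obtain ⟨q, hq, rfl⟩ := List.mem_map.1 hi
        exact List.mem_map_of_mem (List.mem_append_left _ (List.mem_of_mem_take hq))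
    intro i j hij
    rcases (hρ' i j).1 hij with hij | hij
    · exact (hρ i j hij).imp_right fun h => ⟨hsub1 i h.1, hsub1 j h.2⟩
    · exact Or.inr ⟨hsub2 i hij.1, hsub2 j hij.2⟩
  · intro q hq hlq
    rcases (hρ' _ _).1 hlq with h | ⟨-, h⟩
    · rcases hρ _ _ h with h | h
      · exact (hlw q hq).ne h
      · exact hlT h.1
    · rcases List.mem_cons.1 h with h | h
      · exact (hlw q hq).ne' h
      · exact lt_irrefl _ (h2 q.1 (by simpa using h) q.1 (Or.inr (List.mem_map_of_mem hq)))
  · intro τ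
    rw [hle]
    refine and_congr_right fun _ => ⟨fun h p hp => ?_, fun h => ?_⟩
    · exact h _ (List.mem_cons_of_mem _ (List.mem_map_of_mem hp)) _ (List.mem_cons_self ..)
    · have h' : ∀ i ∈ l :: (o.take k).map Prod.fst, τ.1 i l := by
        intro i hi
        rcases List.mem_cons.1 hi with rfl | hi
        · exact τ.1.refl _
        · obtain ⟨q, hq, rfl⟩ := List.mem_map.1 hi
          exact h q hq
      exact fun i hi j hj => τ.1.trans (h' i hi) (τ.1.symm (h' j hj))

theorem nestedSum_mem_coarserSpan {o w : List (Fin n × A)} {c : A}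
    (how : ((o.reverse ++ w).map Prod.fst).Pairwise (· < ·)) :
    (fun τ : NC n => nestedSum ψ τ.1 o c w) ∈
      coarserSpan A fun ρ => ρ.SupportedOn ((o ++ w).map Prod.fst) := by
  induction w generalizing o c with
  | nil =>
    refine AddSubgroup.subset_closure ⟨⟨⊥, ?_⟩, if o = [] then c else 0, ?_, ?_⟩
    · rintro ⟨i, j, k, l, hij, hjk, -, hik, -⟩
      exact (hij.trans hjk).ne hik
    · exact fun i j hij => Or.inl hij
    · funext τ
      have : (⟨⊥, by
        rintro ⟨i, j, k, l, hij, hjk, -, hik, -⟩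
        exact (hij.trans hjk).ne hik⟩ : NC n) ≤ τ := (bot_le : (⊥ : Setoid (Fin n)) ≤ τ.1)
      rw [if_pos this, nestedSum]
  | cons y w ih =>
    obtain ⟨l, x⟩ := y
    simp only [nestedSum]
    refine AddSubgroup.add_mem _ ?_ ?_
    · refine coarserSpan_mono (fun ρ hρ i j hij => ?_) (ih (c := 1) (o := (l, c * x) :: o) (by
        simpa using how))
      have := hρ i j hij
      simp only [List.map_append, List.map_cons, List.mem_append, List.mem_cons] at this ⊢
      tauto
    · have := (coarserSpan A fun ρ => ρ.SupportedOn ((o ++ (l, x) :: w).map Prod.fst)).sum_mem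
        (t := Finset.range (o.length + 1)) fun k _ =>
          coarserSpan_mono (fun ρ hρ => hρ.1) (nestedSum_close_mem_coarserSpan k how
            (ih (c := wickCumulant ψ (c * x) ((o.take k).map Prod.snd))
              (pairwise_drop_append k how)))
      convert this using 1
      funext τ
      rw [Finset.sum_apply]

/-- The free cumulant of a nonempty word (last letter first), in terms of Wick products. -/
noncomputable def wordCumulant (ψ : A →ₗ[ℂ] A) : List A → A
  | [] => 0
  | a :: o => wickCumulant ψ a o

-- Closing a block before the end of the word contributes only `ρ ≠ ⊤`. Modulo such terms, what
-- survives is pushing every letter and closing all of them at the last one.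
open Classical in
theorem nestedSum_sub_mem_coarserSpan {o w : List (Fin n × A)} {c : A} (hw : w ≠ [])
    (how : ((o.reverse ++ w).map Prod.fst).Pairwise (· < ·)) :
    (fun τ : NC n => nestedSum ψ τ.1 o c w -
      if ∀ p ∈ o ++ w, ∀ q ∈ o ++ w, τ.1 p.1 q.1 then
        wordCumulant ψ (((mulHead c w).reverse ++ o).map Prod.snd) else 0) ∈
      coarserSpan A fun ρ => ∃ i j, ¬ ρ.1 i j := by
  induction w generalizing o c with
  | nil => exact absurd rfl hw
  | cons y w ih =>
    obtain ⟨l, x⟩ := y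
    by_cases hwn : w = []
    · subst hwn
      convert (coarserSpan A fun ρ : NC n => ∃ i j, ¬ ρ.1 i j).zero_mem using 1
      funext τ
      -- At the last letter only `k = o.length` empties the stack.
      rw [Pi.zero_apply, sub_eq_zero, nestedSum, Finset.sum_range_succ, Finset.sum_eq_zero]
      · have : (∀ p ∈ o ++ [(l, x)], ∀ q ∈ o ++ [(l, x)], τ.1 p.1 q.1) ↔ ∀ p ∈ o, τ.1 p.1 l := by
          constructor
          · exact fun h p hp => h p (by simp [hp]) (l, x) (by simp)
          · intro h
            have h' : ∀ p ∈ o ++ [(l, x)], τ.1 p.1 l := by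
              intro p hp
              rcases List.mem_append.1 hp with hp | hp
              · exact h p hp
              · rw [List.mem_singleton.1 hp]
            exact fun p hp q hq => τ.1.trans (h' p hp) (τ.1.symm (h' q hq))
        rw [if_congr this rfl rfl]
        simp [nestedSum, mulHead, wordCumulant]
      · intro k hk
        rw [Finset.mem_range] at hk
        have : o.drop k ≠ [] := by simpa using hk
        simp [nestedSum, this]
    · have h1 := ih (c := 1) (o := (l, c * x) :: o) hwn (by simpa using how)
      have h2 := (coarserSpan A fun ρ : NC n => ∃ i j, ¬ ρ.1 i j).sum_mem
        (t := Finset.range (o.length + 1)) fun k _ =>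
          coarserSpan_mono (fun ρ hρ => by
            obtain ⟨q, hq⟩ := List.exists_mem_of_ne_nil w hwn
            exact ⟨l, q.1, hρ.2 q hq⟩) (nestedSum_close_mem_coarserSpan k how
            (nestedSum_mem_coarserSpan (ψ := ψ)
              (c := wickCumulant ψ (c * x) ((o.take k).map Prod.snd))
              (pairwise_drop_append k how)))
      convert AddSubgroup.add_mem _ h1 h2 using 1
      funext τ
      have hiff : (∀ p ∈ o ++ (l, x) :: w, ∀ q ∈ o ++ (l, x) :: w, τ.1 p.1 q.1) ↔
          ∀ p ∈ (l, c * x) :: o ++ w, ∀ q ∈ (l, c * x) :: o ++ w, τ.1 p.1 q.1 := by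
        have hmem : ∀ Q : Fin n → Prop, (∀ p ∈ o ++ (l, x) :: w, Q p.1) ↔
            ∀ p ∈ (l, c * x) :: o ++ w, Q p.1 := by
          intro Q
          simp only [List.mem_append, List.mem_cons, or_imp, forall_and, forall_eq]
          tauto
        rw [hmem fun i => ∀ q ∈ o ++ (l, x) :: w, τ.1 i q.1]
        exact forall₂_congr fun p _ => hmem fun j => τ.1 p.1 j
      have hlist : (mulHead c ((l, x) :: w)).reverse ++ o =
          (mulHead 1 w).reverse ++ (l, c * x) :: o := by
        rw [mulHead_one]
        simp [mulHead]
      rw [Pi.add_apply, Finset.sum_apply, nestedSum, hlist, if_congr hiff rfl rfl]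
      abel

theorem freeCumulant_eq_wordCumulant (hψ : IsCondExp B ψ) (X : Fin (n + 1) → A) :
    freeCumulant ψ X = wordCumulant ψ (List.ofFn X).reverse := by
  classical
  set w : List (Fin (n + 1) × A) := List.ofFn fun i => (i, X i) with hw
  have hwn : w ≠ [] := by simp [hw]
  have hfst : w.map Prod.fst = List.finRange (n + 1) := by
    rw [hw, List.map_ofFn, ← List.ofFn_id]
    rfl
  have hsnd : w.map Prod.snd = List.ofFn X := by
    rw [hw, List.map_ofFn]
    rfl
  have hsorted : (w.map Prod.fst).Pairwise (· < ·) := by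
    rw [hfst]; exact List.pairwise_lt_finRange _
  have hmom : ∀ σ : NC (n + 1), partitionedMoment ψ σ X = nestedSum ψ σ.1 [] 1 w := by
    intro σ
    rw [partitionedMoment, ← hw, partitionedMomentAux_eq_nestedSum hψ σ.2 B.one_mem hwn
      (by simpa using hsorted) (by simp), mulHead_one, List.nil_append]
  have key := sum_mu_smul_of_mem_coarserSpan (nestedSum_sub_mem_coarserSpan (ψ := ψ) (o := [])
    (c := 1) hwn (by simpa using hsorted))
  have htop : ∀ σ : NC (n + 1), (∀ p ∈ [] ++ w, ∀ q ∈ [] ++ w, σ.1 p.1 q.1) ↔ σ = ⊤ := by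
    intro σ
    constructor
    · intro h
      refine top_le_iff.1 fun i j _ => ?_
      have hmem : ∀ i, (i, X i) ∈ [] ++ w := fun i => List.mem_ofFn.2 ⟨i, rfl⟩
      exact h _ (hmem i) _ (hmem j)
    · rintro rfl
      exact fun _ _ _ _ => trivial
  simp only [htop, smul_sub, Finset.sum_sub_distrib, sub_eq_zero, smul_ite, smul_zero,
    Finset.sum_ite_eq', Finset.mem_univ, if_true, IncidenceAlgebra.mu_self, one_smul, mulHead_one,
    List.append_nil, List.map_reverse, hsnd] at key
  rw [← key, freeCumulant, partitionedCumulant]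
  simp only [le_top, Finset.filter_true, hmom]

end MoebiusInversion

/-! ### Freeness in terms of `ψ` on alternating words -/

section AlternatingWords

variable {A : Type*} [Ring A] [Algebra ℂ A]

/-- Products `x₁ β₁ x₂ ⋯ βₖ xₖ₊₁` of `φ`-centred elements taken alternatingly from `N` and `B`. -/
inductive AltWord (φ : A →ₗ[ℂ] A) (N B : Subalgebra ℂ A) : A → Prop
  | base {x : A} : x ∈ N → φ x = 0 → AltWord φ N B x
  | step {w β x : A} : AltWord φ N B w → β ∈ B → φ β = 0 → x ∈ N → φ x = 0 →
      AltWord φ N B (w * β * x)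

/-- `w` is an alternating product of centred elements of the algebras `S`, the last of which belongs
to `S k`. -/
def IsAltProd {ι : Type*} (φ : A →ₗ[ℂ] A) (S : ι → Subalgebra ℂ A) (k : ι) (w : A) : Prop :=
  ∃ (n : ℕ) (i : Fin (n + 1) → ι) (X : Fin (n + 1) → A),
    (∀ j, X j ∈ S (i j)) ∧ (∀ j, φ (X j) = 0) ∧ (∀ j : Fin n, i j.castSucc ≠ i j.succ) ∧
      i (Fin.last n) = k ∧ (List.ofFn X).prod = w

variable {φ ψ : A →ₗ[ℂ] A} {N B C : Subalgebra ℂ A}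

theorem IsAltProd.single {ι : Type*} {S : ι → Subalgebra ℂ A} {k : ι} {x : A} (hx : x ∈ S k)
    (h0 : φ x = 0) : IsAltProd φ S k x :=
  ⟨0, fun _ => k, fun _ => x, fun _ => hx, fun _ => h0, fun j => j.elim0, rfl, by simp⟩

theorem IsAltProd.mul {ι : Type*} {S : ι → Subalgebra ℂ A} {k l : ι} {w x : A}
    (hw : IsAltProd φ S k w) (hkl : k ≠ l) (hx : x ∈ S l) (h0 : φ x = 0) :
    IsAltProd φ S l (w * x) := by
  obtain ⟨n, i, X, hX, hX0, hi, rfl, rfl⟩ := hw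
  refine ⟨n + 1, Fin.snoc (α := fun _ => ι) i l, Fin.snoc (α := fun _ => A) X x, ?_, ?_, ?_, ?_, ?_⟩
  · intro j
    induction j using Fin.lastCases with
    | last => simpa using hx
    | cast j => simpa using hX j
  · intro j
    induction j using Fin.lastCases with
    | last => simpa using h0
    | cast j => simpa using hX0 j
  · intro j
    induction j using Fin.lastCases with
    | last => rw [Fin.succ_last, Fin.snoc_last, Fin.snoc_castSucc]; exact hkl
    | cast j => rw [Fin.succ_castSucc, Fin.snoc_castSucc, Fin.snoc_castSucc]; exact hi j
  · simp
  · rw [List.ofFn_succ']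
    simp [mul_assoc]

theorem AltWord.isAltProd {w : A} (hw : AltWord φ N B w) : IsAltProd φ ![N, B] 0 w := by
  induction hw with
  | base hx h0 => exact .single hx h0
  | step _ hβ hβ0 hx h0 ih => exact (ih.mul (l := 1) (by simp) hβ hβ0).mul (by simp) hx h0

theorem IsFreeWithAmalgamation.map_isAltProd {ι : Type*} {S : ι → Subalgebra ℂ A}
    (h : IsFreeWithAmalgamation φ S) {k : ι} {w : A} (hw : IsAltProd φ S k w) : φ w = 0 := by
  obtain ⟨n, i, X, hX, hX0, hi, -, rfl⟩ := hw
  exact h n i X hX hX0 hi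

/-- For `b ∈ B`, `φ(ψ(w) b) = φ(w (b - φ(b))) + φ(w) φ(b)`; freeness kills both terms, and
faithfulness then gives `ψ(w) = 0`. -/
theorem IsFreeWithAmalgamation.map_altWord (hfree : IsFreeWithAmalgamation φ ![N, B])
    (hCB : C ≤ B) (hψ : IsCondExp B ψ) (hφ : IsCondExp C φ) (hφψ : ∀ x, φ (ψ x) = φ x)
    (hfaithful : IsFaithfulOn φ B) {w : A} (hw : AltWord φ N B w) : ψ w = 0 := by
  refine hfaithful _ (hψ.map_mem w) fun b hb => ?_
  have hwφ : φ w = 0 := hfree.map_isAltProd hw.isAltProd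
  have hb0 : φ (w * (b - φ b)) = 0 := hfree.map_isAltProd
    (hw.isAltProd.mul (l := 1) (by simp) (B.sub_mem hb (hCB (hφ.map_mem b)))
      (by rw [map_sub, hφ.map_map, sub_self]))
  rw [← hψ.map_mul_right hb, hφψ]
  rwa [mul_sub, map_sub, hφ.map_mul_right (hφ.map_mem b), hwφ, zero_mul, sub_zero] at hb0

/-- Unless it is a single element of `B`, an alternating product is a word from `N` to `N` with
possible outer factors in `B`, which pass through `ψ`. -/
theorem isFreeWithAmalgamation_of_map_altWord (hψ : IsCondExp B ψ) (hφψ : ∀ x, φ (ψ x) = φ x)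
    (h : ∀ w, AltWord φ N B w → ψ w = 0) : IsFreeWithAmalgamation φ ![N, B] := by
  have key : ∀ (n : ℕ) (i : Fin (n + 1) → Fin 2) (X : Fin (n + 1) → A),
      (∀ j, X j ∈ (![N, B] : Fin 2 → Subalgebra ℂ A) (i j)) → (∀ j, φ (X j) = 0) →
      (∀ j : Fin n, i j.castSucc ≠ i j.succ) →
      (i (Fin.last n) = 0 ∧ ∃ β ∈ B, ∃ w, AltWord φ N B w ∧ (List.ofFn X).prod = β * w) ∨
      (i (Fin.last n) = 1 ∧ (((List.ofFn X).prod ∈ B ∧ φ (List.ofFn X).prod = 0) ∨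
        ∃ β ∈ B, ∃ w, AltWord φ N B w ∧ ∃ β' ∈ B, φ β' = 0 ∧
          (List.ofFn X).prod = β * w * β')) := by
    intro n
    induction n with
    | zero =>
      intro i X hX hX0 hi
      have hX1 := hX (Fin.last 0)
      have hp : (List.ofFn X).prod = X (Fin.last 0) := by simp
      rw [hp]
      rcases (by omega : i (Fin.last 0) = 0 ∨ i (Fin.last 0) = 1) with h0 | h1
      · rw [h0] at hX1
        exact Or.inl ⟨h0, 1, B.one_mem, _, .base hX1 (hX0 _), (one_mul _).symm⟩
      · rw [h1] at hX1
        exact Or.inr ⟨h1, Or.inl ⟨hX1, hX0 _⟩⟩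
    | succ n ih =>
      intro i X hX hX0 hi
      have hX1 := hX (Fin.last (n + 1))
      have hne := hi (Fin.last n)
      rw [Fin.succ_last] at hne
      change _ ≠ i (Fin.last (n + 1)) at hne
      have hp : (List.ofFn X).prod =
          (List.ofFn fun j : Fin (n + 1) => X j.castSucc).prod * X (Fin.last (n + 1)) := by
        rw [List.ofFn_succ']
        simp [mul_assoc]
      rw [hp]
      rcases ih (fun j => i j.castSucc) (fun j => X j.castSucc) (fun j => hX _) (fun j => hX0 _)
        (fun j => hi j.castSucc) with ⟨h0, β, hβ, w, hw, hprod⟩ | ⟨h1, hcase⟩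
      · have h1 : i (Fin.last (n + 1)) = 1 := by omega
        rw [h1] at hX1
        exact Or.inr ⟨h1, Or.inr ⟨β, hβ, w, hw, _, hX1, hX0 _, by rw [hprod]⟩⟩
      · have h0 : i (Fin.last (n + 1)) = 0 := by omega
        rw [h0] at hX1
        rcases hcase with ⟨hB, -⟩ | ⟨β, hβ, w, hw, β', hβ', hβ0, hprod⟩
        · exact Or.inl ⟨h0, _, hB, _, .base hX1 (hX0 _), rfl⟩
        · exact Or.inl ⟨h0, β, hβ, _, .step hw hβ' hβ0 hX1 (hX0 _), by rw [hprod]; noncomm_ring⟩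
  intro n i X hX hX0 hi
  rcases key n i X hX hX0 hi with ⟨-, β, hβ, w, hw, hprod⟩ |
    ⟨-, ⟨-, h0⟩ | ⟨β, hβ, w, hw, β', hβ', -, hprod⟩⟩
  · rw [hprod, ← hφψ, hψ.map_mul_left hβ, h w hw, mul_zero, map_zero]
  · exact h0
  · rw [hprod, ← hφψ, hψ.map_bimodule β hβ β' hβ', h w hw, mul_zero, zero_mul, map_zero]

end AlternatingWords

/-! ### Cumulants and alternating words -/

section Cumulants

variable {A : Type*} [Ring A] [Algebra ℂ A] {φ ψ : A →ₗ[ℂ] A} {N B C : Subalgebra ℂ A}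

theorem freeCumulant_interlace (hψ : IsCondExp B ψ) {n : ℕ} (X : Fin (n + 1) → A)
    (b : Fin n → A) :
    freeCumulant ψ (interlace X b) = wickCumulant ψ (X (Fin.last n))
      ((List.ofFn fun i => X i.castSucc * b i).reverse) := by
  rw [freeCumulant_eq_wordCumulant hψ, List.ofFn_succ']
  simp [interlace, wordCumulant]

/-- The words `x₁ b₁, …, xₙ bₙ` with `xᵢ ∈ N` and `bᵢ ∈ B`. -/
def IsWordOver (N B : Subalgebra ℂ A) (o : List (A × A)) : Prop :=
  ∀ p ∈ o, p.1 ∈ N ∧ p.2 ∈ B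

theorem freeCumulant_interlace_eq_iff (hψ : IsCondExp B ψ) (hφ : IsCondExp C φ) :
    (∀ (n : ℕ) (X : Fin (n + 1) → A) (b : Fin n → A), (∀ i, X i ∈ N) → (∀ i, b i ∈ B) →
      freeCumulant ψ (interlace X b) = freeCumulant φ (interlace X fun i => φ (b i))) ↔
    ∀ x ∈ N, ∀ o : List (A × A), IsWordOver N B o →
      wickCumulant ψ x (o.map fun p => p.1 * p.2) =
        wickCumulant φ x (o.map fun p => p.1 * φ p.2) := by
  constructor
  · intro h x hx o ho
    have := h o.reverse.length
      (Fin.snoc (α := fun _ => A) (fun i => (o.reverse.get i).1) x)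
      (fun i => (o.reverse.get i).2) ?_ ?_
    · rw [freeCumulant_interlace hψ, freeCumulant_interlace hφ] at this
      have hlist : ∀ f : A × A → A,
          (List.ofFn fun i => f (o.reverse.get i)).reverse = o.map f := by
        intro f
        have : (fun i => f (o.reverse.get i)) = f ∘ o.reverse.get := rfl
        rw [this, ← List.map_ofFn, List.ofFn_get, ← List.map_reverse, List.reverse_reverse]
      simpa only [Fin.snoc_last, Fin.snoc_castSucc, hlist fun p => p.1 * p.2,
        hlist fun p => p.1 * φ p.2] using this
    · intro i
      induction i using Fin.lastCases with
      | last => simpa using hx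
      | cast i =>
        rw [Fin.snoc_castSucc]
        exact (ho _ (List.mem_reverse.1 (List.get_mem _ _))).1
    · exact fun i => (ho _ (List.mem_reverse.1 (List.get_mem _ _))).2
  · intro h n X b hX hb
    rw [freeCumulant_interlace hψ, freeCumulant_interlace hφ]
    have := h _ (hX (Fin.last n)) (List.ofFn fun i : Fin n => (X i.castSucc, b i)).reverse ?_
    · simpa only [List.map_reverse, List.map_ofFn, Function.comp_def] using this
    · intro p hp
      rw [List.mem_reverse, List.mem_ofFn] at hp
      obtain ⟨i, rfl⟩ := hp
      exact ⟨hX _, hb i⟩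

/-- The recursion never leaves `N`, so the two maps are only ever compared there. -/
theorem wick_eq_of_eqOn (hφN : ∀ x ∈ N, φ x ∈ N) (h : ∀ x ∈ N, ψ x = φ x) {o : List A}
    (ho : ∀ a ∈ o, a ∈ N) : wick ψ o = wick φ o ∧ wick φ o ∈ N := by
  induction hn : o.length using Nat.strong_induction_on generalizing o with
  | _ n ih =>
    cases o with
    | nil => exact ⟨by rw [wick_nil, wick_nil], by rw [wick_nil]; exact N.one_mem⟩
    | cons a o =>
      have ha : a ∈ N := ho a (by simp)
      have ho' : ∀ a ∈ o, a ∈ N := fun a ha => ho a (by simp [ha])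
      rw [List.length_cons] at hn
      have ihd := fun k => ih (o.drop k).length (by simp; omega)
        (fun a ha => ho' a (List.mem_of_mem_drop ha)) rfl
      have iht := fun k => ih (o.take k).length (by simp; omega)
        (fun a ha => ho' a (List.mem_of_mem_take ha)) rfl
      have iho := ih o.length (by omega) ho' rfl
      rw [wick_cons, wick_cons, wordConv, wordConv]
      refine ⟨?_, ?_⟩
      · rw [iho.1]
        congr 1
        refine Finset.sum_congr rfl fun k _ => ?_
        rw [(ihd k).1, wickCumulant, (iht k).1, h _ (N.mul_mem (iht k).2 ha)]
        rfl
      · exact N.sub_mem (N.mul_mem iho.2 ha) (N.sum_mem fun k _ =>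
          N.mul_mem (ihd k).2 (hφN _ (N.mul_mem (iht k).2 ha)))

theorem wickCumulant_eq_of_eqOn (hφN : ∀ x ∈ N, φ x ∈ N) (h : ∀ x ∈ N, ψ x = φ x) {x : A}
    (hx : x ∈ N) {o : List A} (ho : ∀ a ∈ o, a ∈ N) :
    wickCumulant ψ x o = wickCumulant φ x o := by
  obtain ⟨h1, h2⟩ := wick_eq_of_eqOn hφN h ho
  rw [wickCumulant, h1, h _ (N.mul_mem h2 hx), wickCumulant]

/-- For centred letters all corrections vanish, so an alternating word is itself a nonempty Wick
product. -/
theorem map_altWord_of_wickCumulant (hψ : IsCondExp B ψ)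
    (h : ∀ x ∈ N, ∀ o : List (A × A), IsWordOver N B o →
      wickCumulant ψ x (o.map fun p => p.1 * p.2) = wickCumulant φ x (o.map fun p => p.1 * φ p.2))
    {w : A} (hw : AltWord φ N B w) : ψ w = 0 := by
  have hcons : ∀ (x : A) (o : List (A × A)), x ∈ N → φ x = 0 → IsWordOver N B o →
      (∀ p ∈ o, φ p.2 = 0) → wick ψ (x :: o.map fun p => p.1 * p.2) =
        wick ψ (o.map fun p => p.1 * p.2) * x := by
    intro x o hx hx0 ho ho0
    rw [wick_cons, sub_eq_self, wordConv]
    refine Finset.sum_eq_zero fun k _ => ?_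
    rw [← List.map_take, h x hx _ fun p hp => ho p (List.mem_of_mem_take hp)]
    have ho0' : ∀ p ∈ o.take k, φ p.2 = 0 := fun p hp => ho0 p (List.mem_of_mem_take hp)
    generalize o.take k = u at ho0'
    cases u with
    | nil => simp [wickCumulant, wick_nil, hx0]
    -- The letter next to `x` is `p.1 * φ p.2 = 0`.
    | cons p u => simp [wickCumulant, ho0' p (by simp), wick_zero_cons]
  have key : ∃ (x : A) (o : List (A × A)), x ∈ N ∧ φ x = 0 ∧ IsWordOver N B o ∧
      (∀ p ∈ o, φ p.2 = 0) ∧ w = wick ψ (x :: o.map fun p => p.1 * p.2) := by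
    induction hw with
    | @base x hx h0 =>
      refine ⟨x, [], hx, h0, by simp [IsWordOver], by simp, ?_⟩
      rw [hcons x [] hx h0 (by simp [IsWordOver]) (by simp)]
      simp [wick_nil]
    | @step w β x hw hβ hβ0 hx h0 ih =>
      obtain ⟨y, o, hy, hy0, ho, ho0, rfl⟩ := ih
      have ho' : IsWordOver N B ((y, β) :: o) := by
        intro p hp
        rcases List.mem_cons.1 hp with rfl | hp
        · exact ⟨hy, hβ⟩
        · exact ho p hp
      have ho0' : ∀ p ∈ (y, β) :: o, φ p.2 = 0 := by
        intro p hp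
        rcases List.mem_cons.1 hp with rfl | hp
        · exact hβ0
        · exact ho0 p hp
      refine ⟨x, (y, β) :: o, hx, h0, ho', ho0', ?_⟩
      rw [hcons x _ hx h0 ho' ho0', List.map_cons, wick_mul_right hψ _ hβ]
  obtain ⟨x, o, -, -, -, -, rfl⟩ := key
  exact hψ.map_wick_cons _ _

/-- For a word `x₁ b₁, …, xₙ bₙ` (last letter first), its Wick product with `bₙ` replaced by
`bₙ - φ bₙ`. -/
noncomputable def centredWick (ψ φ : A →ₗ[ℂ] A) : List (A × A) → A
  | [] => 1
  | p :: o => wick ψ (p.1 :: o.map fun p => p.1 * p.2) * (p.2 - φ p.2)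

theorem altWord_closure_mul (φ : A →ₗ[ℂ] A) {w β x : A}
    (hw : w ∈ AddSubmonoid.closure {w | AltWord φ N B w}) (hβ : β ∈ B) (hβ0 : φ β = 0)
    (hx : x ∈ N) (hx0 : φ x = 0) : w * β * x ∈ AddSubmonoid.closure {w | AltWord φ N B w} := by
  induction hw using AddSubmonoid.closure_induction with
  | mem w hw => exact AddSubmonoid.subset_closure (AltWord.step hw hβ hβ0 hx hx0)
  | zero => simp
  | add v w _ _ hv hw => rw [add_mul, add_mul]; exact AddSubmonoid.add_mem _ hv hw

/-- The three claims feed each other in one induction on length: expansions of shorter words yield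
the cumulant, which in turn yields the expansion at full length. -/
theorem wickCumulant_eq_of_map_altWord (hCB : C ≤ B) (hCN : C ≤ N) (hψ : IsCondExp B ψ)
    (hφ : IsCondExp C φ) (h : ∀ w, AltWord φ N B w → ψ w = 0) {x : A} (hx : x ∈ N)
    {o : List (A × A)} (ho : IsWordOver N B o) :
    wickCumulant ψ x (o.map fun p => p.1 * p.2) = wickCumulant φ x (o.map fun p => p.1 * φ p.2) ∧
    wick ψ (x :: o.map fun p => p.1 * p.2) = wordConv (centredWick ψ φ)
      (fun u => wick φ (x :: u.map fun p => p.1 * φ p.2)) o ∧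
    wick ψ (x :: o.map fun p => p.1 * p.2) ∈ AddSubmonoid.closure {w | AltWord φ N B w} := by
  induction hn : o.length using Nat.strong_induction_on generalizing x o with
  | _ n ih =>
    have hφN : ∀ x ∈ N, φ x ∈ N := fun x _ => hCN (hφ.map_mem x)
    set Z : List (A × A) → A := fun u => wick ψ (u.map fun p => p.1 * p.2) with hZ
    set Y : List (A × A) → A := fun u => wick φ (u.map fun p => p.1 * φ p.2) with hY
    set K : List (A × A) → A := fun u => wickCumulant φ x (u.map fun p => p.1 * φ p.2) with hK
    set U : List (A × A) → A := fun u => wick φ (x :: u.map fun p => p.1 * φ p.2) with hU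
    -- Split the final `b` into `b - φ b` and `φ b`; the first part is the term with empty right
    -- segment, the second is expanded by induction.
    have hsuff : ∀ v, v <:+ o → Z v = wordConv (centredWick ψ φ) Y v := by
      intro v hv
      cases v with
      | nil => simp [wordConv_nil, hZ, hY, centredWick, wick_nil]
      | cons p v =>
        have hlen := hv.length_le
        rw [List.length_cons] at hlen
        have hp := ho p (hv.subset (by simp))
        obtain ⟨-, h2, -⟩ := ih v.length (by omega) hp.1
          (fun q hq => ho q (hv.subset (by simp [hq]))) rfl
        have hYp : (fun u => Y (p :: u)) =
            fun u => wick φ (p.1 :: u.map fun p => p.1 * φ p.2) * φ p.2 := by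
          funext u
          simp only [hY, List.map_cons]
          exact wick_mul_right hφ _ (hφ.map_mem _) _
        rw [wordConv_cons, hYp, wordConv_mul_right, ← h2]
        simp only [hZ, hY, List.map_cons, List.map_nil, wick_nil, centredWick]
        rw [wick_mul_right hψ _ hp.2]
        noncomm_ring
    -- The left side is the Wick recursion with the expected cumulants `K` in place of those of `ψ`,
    -- which are not yet known at full length.
    have hW : Z o * x - wordConv Z K o = wordConv (centredWick ψ φ) U o := by
      have hUeq : U = fun u => Y u * x - wordConv Y K u := by
        funext u
        simp only [hU, wick_cons, wordConv_map]
        rfl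
      rw [hUeq, wordConv_sub_right, wordConv_mul_right, ← hsuff o List.suffix_rfl,
        wordConv_congr hsuff fun _ _ => rfl, wordConv_assoc]
    have hWE : wordConv (centredWick ψ φ) U o ∈ AddSubmonoid.closure {w | AltWord φ N B w} := by
      refine AddSubmonoid.sum_mem _ fun k _ => ?_
      have hUN : U (o.take k) ∈ N := by
        refine (wick_eq_of_eqOn (ψ := φ) hφN (fun _ _ => rfl) fun a ha => ?_).2
        rcases List.mem_cons.1 ha with rfl | ha
        · exact hx
        · obtain ⟨p, hp, rfl⟩ := List.mem_map.1 ha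
          exact N.mul_mem (ho p (List.mem_of_mem_take hp)).1 (hCN (hφ.map_mem _))
      have hU0 : φ (U (o.take k)) = 0 := hφ.map_wick_cons _ _
      have hsub : ∀ p ∈ o.drop k, p ∈ o := fun p hp => List.mem_of_mem_drop hp
      have hlen : (o.drop k).length ≤ o.length := by simp
      generalize o.drop k = v at hsub hlen
      cases v with
      | nil =>
        rw [centredWick, one_mul]
        exact AddSubmonoid.subset_closure (.base hUN hU0)
      | cons p v =>
        rw [List.length_cons] at hlen
        have hp := ho p (hsub p (by simp))
        obtain ⟨-, -, h3⟩ := ih v.length (by omega) hp.1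
          (fun q hq => ho q (hsub q (by simp [hq]))) rfl
        exact altWord_closure_mul φ h3 (B.sub_mem hp.2 (hCB (hφ.map_mem _)))
          (by rw [map_sub, hφ.map_map, sub_self]) hUN hU0
    have hψE : ∀ w ∈ AddSubmonoid.closure {w | AltWord φ N B w}, ψ w = 0 := by
      intro w hw
      induction hw using AddSubmonoid.closure_induction with
      | mem w hw => exact h w hw
      | zero => exact map_zero ψ
      | add v w _ _ hv hw => rw [map_add, hv, hw, add_zero]
    have hcum : wickCumulant ψ x (o.map fun p => p.1 * p.2) = K o := by
      -- Applying `ψ` to `hW` kills the right side and leaves the cumulant of `ψ` minus `K o` on the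
      -- left.
      have h0 := hψE _ hWE
      rw [← hW, map_sub, hψ.map_wordConv _ _ fun u => hCB (wickCumulant_mem hφ _ _),
        wordConv_eq_of_left, sub_eq_zero] at h0
      · exact h0
      · simpa [hZ, wick_nil] using hψ.map_self 1 B.one_mem
      · exact fun p u _ => hψ.map_wick_cons _ _
    have heq : wick ψ (x :: o.map fun p => p.1 * p.2) = wordConv (centredWick ψ φ) U o := by
      rw [← hW, wick_cons, wordConv_map]
      congr 1
      refine wordConv_congr (fun _ _ => rfl) fun u hu => ?_
      rcases hu.length_le.eq_or_lt with hlen | hlen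
      · rw [hu.eq_of_length hlen]
        exact hcum
      · exact (ih u.length (by omega) hx (fun p hp => ho p (hu.subset hp)) rfl).1
    exact ⟨hcum, heq, heq ▸ hWE⟩

end Cumulants

/-! ### The main theorem -/

theorem mainTheorem2 {A : Type*} [Ring A] [Algebra ℂ A] (C B N : Subalgebra ℂ A)
    (hCB : C ≤ B) (hCN : C ≤ N) (ψ φ : A →ₗ[ℂ] A)
    (hψ : IsCondExp B ψ) (hφ : IsCondExp C φ) (hφψ : ∀ x : A, φ (ψ x) = φ x)
    (hfaithful : IsFaithfulOn φ B) :
    (IsFreeWithAmalgamation φ ![N, B] ↔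
      ∀ (n : ℕ) (X : Fin (n + 1) → A) (b : Fin n → A), (∀ i, X i ∈ N) → (∀ i, b i ∈ B) →
        freeCumulant ψ (interlace X b) =
          φ (freeCumulant ψ (interlace X fun i => φ (b i)))) ∧
    ((∀ (n : ℕ) (X : Fin (n + 1) → A) (b : Fin n → A), (∀ i, X i ∈ N) → (∀ i, b i ∈ B) →
        freeCumulant ψ (interlace X b) =
          φ (freeCumulant ψ (interlace X fun i => φ (b i)))) ↔
      ∀ (n : ℕ) (X : Fin (n + 1) → A) (b : Fin n → A), (∀ i, X i ∈ N) → (∀ i, b i ∈ B) →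
        freeCumulant ψ (interlace X b) =
          freeCumulant φ (interlace X fun i => φ (b i))) := by
  have hequiv : (∀ (n : ℕ) (X : Fin (n + 1) → A) (b : Fin n → A), (∀ i, X i ∈ N) →
      (∀ i, b i ∈ B) → freeCumulant ψ (interlace X b) =
          φ (freeCumulant ψ (interlace X fun i => φ (b i)))) ↔
      ∀ (n : ℕ) (X : Fin (n + 1) → A) (b : Fin n → A), (∀ i, X i ∈ N) → (∀ i, b i ∈ B) →
        freeCumulant ψ (interlace X b) =
          freeCumulant φ (interlace X fun i => φ (b i)) := by
    have hmem : ∀ {n : ℕ} (X : Fin (n + 1) → A) (b : Fin n → A),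
        φ (freeCumulant φ (interlace X b)) = freeCumulant φ (interlace X b) := by
      intro n X b
      rw [freeCumulant_interlace hφ]
      exact hφ.map_self _ (wickCumulant_mem hφ _ _)
    constructor
    · intro h n X b hX hb
      -- The condition for one letter reads `ψ x = φ (ψ x)`.
      have hN : ∀ x ∈ N, ψ x = φ x := by
        intro x hx
        have := h 0 (fun _ => x) (fun i => i.elim0) (fun _ => hx) (fun i => i.elim0)
        rw [freeCumulant_interlace hψ, freeCumulant_interlace hψ] at this
        simpa [wickCumulant, wick_nil, hφψ] using this
      have heq : freeCumulant ψ (interlace X fun i => φ (b i)) =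
          freeCumulant φ (interlace X fun i => φ (b i)) := by
        rw [freeCumulant_interlace hψ, freeCumulant_interlace hφ]
        refine wickCumulant_eq_of_eqOn (fun x _ => hCN (hφ.map_mem x)) hN (hX _) fun a ha => ?_
        rw [List.mem_reverse, List.mem_ofFn] at ha
        obtain ⟨i, rfl⟩ := ha
        exact N.mul_mem (hX _) (hCN (hφ.map_mem _))
      rw [h n X b hX hb, heq, hmem]
    · intro h n X b hX hb
      -- The hypothesis is used a second time with `φ (b i)` for `b i`; idempotence of `φ` closes
      -- the gap.
      rw [h n X b hX hb, h n X _ hX fun i => hCB (hφ.map_mem (b i)), hmem]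
      simp only [hφ.map_map]
  refine ⟨?_, hequiv⟩
  rw [hequiv, freeCumulant_interlace_eq_iff hψ hφ]
  constructor
  · intro hfree x hx o ho
    exact (wickCumulant_eq_of_map_altWord hCB hCN hψ hφ
      (fun w hw => hfree.map_altWord hCB hψ hφ hφψ hfaithful hw) hx ho).1
  · intro h
    exact isFreeWithAmalgamation_of_map_altWord hψ hφψ fun w hw =>
      map_altWord_of_wickCumulant hψ h hw
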